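/- Let $\omega=e^{i\pi/3}$ and divide the plane into regular hexagonal cells with centres in $\mathbb Z[\omega]$; the edges of a cell are named by the angles $0^\circ,60^\circ,\dots,300^\circ$ of their outer normals. The *subtile* is a hexagon with bumps on its edges at $60^\circ,180^\circ,-120^\circ$ and holes on its edges at $0^\circ,120^\circ,-60^\circ$; it may be rotated by multiples of $60^\circ$ but not flipped. A *tiling* places on every cell a subtile, rotated by $60^\circ k$ with $k\in\mathbb Z/6$, so that along every edge a bump meets a hole. The monotile *HexSeed* consists of 16 subtiles. Writing $(a,b)$ for the cell with centre $a+b\omega$, its subtiles, given as $(a,b){:}k$, are $(0,0){:}0$; $(1,0){:}0$, $(0,1){:}4$, $(-1,1){:}2$, $(-1,0){:}0$, $(0,-1){:}1$, $(1,-1){:}5$; $(1,1){:}2$, $(-1,2){:}3$, $(-2,1){:}4$, $(-1,-1){:}5$, $(1,-2){:}0$, $(2,-1){:}1$; $(0,2){:}4$, $(-2,0){:}0$, $(0,-2){:}1$. The *scale/substitution rule* enlarges a tiling by the factor $4$ and replaces every enlarged subtile by a copy of HexSeed in the same orientation, with the same centre; the copies have to cover every cell exactly once and all edges have to fit. A tiling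 is *built by the rule* if for every $n$ it is, up to a translation, the result of $n$ applications of the rule to some tiling. Every subtile carries a *dendrite motif*: a trunk leaving it (in standard position) at $180^\circ$, into which the three curves entering through its holes run, and two strands that start at *sources* inside the subtile and leave it at $60^\circ$ and at $-120^\circ$. Across an edge, each strand runs into the trunk of the neighbouring subtile. *Dendrites* are the connected components of the union of all these curves. **Theorem.** 1. For each of the six orientations of the subtile at the origin, the rule has exactly one fixed point, i.e. one tiling which the rule turns into itself. 2. Let $P$ be the fixed point whose subtile at the origin is in standard position. Then $P$ is built by the rule. The three strands of the subtile at the origin continue as straight infinite paths at $180^\circ$, $60^\circ$ and $-120^\circ$. The path that starts at any source of $P$ joins exactly one of these three paths, and which one it joins is decidable: for each of the three, the set of sources whose paths join it is computable. If a source's path joins the one at $60^\circ$ (at $-120^\circ$), then the first cell that it enters has its centre strictly above (below) the horizontal line through the origin. 3. In every tiling built by the rule, in particular in $P$, all dendrites are infinite, no path along a dendrite ever returns to a strand that it has left, the dendrites contain no cycle, and the tiling is nonperiodic: no translation of the plane other than the identity maps it to itself. -/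

import Mathlib

namespace HexSeed

/-- Cells of the regular hexagonal grid, in coordinates with respect to `1, ω`, where
`ω = exp (iπ/3)`: the pair `(a, b)` is the hexagon with centre `a + b ω`. -/
abbrev Cell : Type := ℤ × ℤ

/-- The centre of a cell in the plane. -/
noncomputable def centre (x : Cell) : ℂ :=
  (x.1 : ℂ) + (x.2 : ℂ) * Complex.exp (Complex.I * (Real.pi / 3))

/-- Rotation by 60° about the cell `0`. -/
def rot60 (x : Cell) : Cell := (-x.2, x.1 + x.2)

/-- Rotation by `60° * k` about the cell `0`. -/
def rot (k : ZMod 6) (x : Cell) : Cell := rot60^[k.val] x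

/-- The step from a cell to its neighbour at angle `60° * d`; also used as a name of the edge
between the two. -/
def dir (d : ZMod 6) : Cell := rot d (1, 0)

/-- The marking of the subtile. In its standard position (rotation `0`) the subtile has bumps
on its edges at 60°, 180°, -120° and holes on its edges at 0°, 120°, -60°, i.e. the cyclic
word `++--+-`. `IsBump k d`: the subtile rotated by `60° * k` has a bump at its edge at angle
`60° * d`. -/
def IsBump (k d : ZMod 6) : Prop := d - k = 1 ∨ d - k = 3 ∨ d - k = 4

/-- A placement of one subtile, in one of its six rotations (no reflections), on each cell. -/
abbrev Field : Type := Cell → ZMod 6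

/-- Along every edge a bump meets a hole. -/
def Fits (T : Field) : Prop :=
  ∀ (x : Cell) (d : ZMod 6), IsBump (T x) d ↔ ¬ IsBump (T (x + dir d)) (d + 3)

/-- The monotile in standard position: sixteen cells, each with the rotation of its subtile.
Thirteen cells are the interior of the hexagon enlarged by the factor 4; the other three lie
on the midpoints of those edges of the enlarged hexagon where the subtile has a bump. -/
def monotile : Finset (Cell × ZMod 6) :=
  {((0, 0), 0),
   ((1, 0), 0), ((0, 1), 4), ((-1, 1), 2), ((-1, 0), 0), ((0, -1), 1), ((1, -1), 5),
   ((1, 1), 2), ((-1, 2), 3), ((-2, 1), 4), ((-1, -1), 5), ((1, -2), 0), ((2, -1), 1),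
   ((0, 2), 4), ((-2, 0), 0), ((0, -2), 1)}

/-- The copy `m = (c, k)` of the monotile, rotated by `60° * k` and then centred at `c`:
its cells with the rotations of the subtiles on them. -/
def copy (m : Cell × ZMod 6) : Set (Cell × ZMod 6) :=
  {q | ∃ p ∈ monotile, q = (m.1 + rot m.2 p.1, m.2 + p.2)}

/-- The copies `C` of the monotile tile the plane, and `T` is the resulting field of
subtiles: every cell lies in exactly one copy, `T` is what the copies prescribe, and all edges
of subtiles fit. -/
def IsMonotileTiling (C : Set (Cell × ZMod 6)) (T : Field) : Prop :=
  Fits T ∧ (∀ m ∈ C, ∀ q ∈ copy m, T q.1 = q.2) ∧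
    ∀ y : Cell, ∃! m, m ∈ C ∧ y ∈ Prod.fst '' copy m

/-- The scale/substitution rule: `T` arises from the tiling `U` by enlarging it by the factor 4
and replacing every enlarged subtile by the monotile in the same orientation. -/
def Rule (U T : Field) : Prop :=
  Fits U ∧ IsMonotileTiling (Set.range fun x : Cell => ((4 : ℤ) • x, U x)) T

/-- `n` applications of the rule lead from `U` to `T`. -/
def RuleIter : ℕ → Field → Field → Prop
  | 0, U, T => U = T
  | n + 1, U, T => ∃ V, RuleIter n U V ∧ Rule V T

/-- `T` is built by the rule: for every `n` it is, up to a translation, the result of `n`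
applications of the rule to some tiling. -/
def BuiltByRule (T : Field) : Prop :=
  ∀ n : ℕ, ∃ (c : Cell) (U : Field), RuleIter n U (fun x => T (x + c))

/-- The subtiles of `T` as placed in the plane. -/
def placed (T : Field) : Set (ℂ × ZMod 6) := Set.range fun x : Cell => (centre x, T x)

/-- No translation of the plane except the identity maps the tiling to itself. -/
def Nonperiodic (T : Field) : Prop :=
  ∀ v : ℂ, (fun q : ℂ × ZMod 6 => (q.1 + v, q.2)) '' placed T = placed T → v = 0

/-- The strands of the dendrite motif on one subtile: the trunk, into which the three curves
run that enter through the holes, and two strands that start at sources inside the subtile. -/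
inductive Strand
  | trunk
  | sourceA
  | sourceB

/-- The edge of the subtile in standard position through which the strand leaves it:
180° for the trunk, 60° and -120° for the strands of the two sources. -/
def Strand.exit : Strand → ZMod 6
  | .trunk => 3
  | .sourceA => 1
  | .sourceB => 4

/-- A strand on the subtile at some cell. -/
abbrev Node : Type := Cell × Strand

/-- The strand leaves its subtile through a bump and runs into the trunk of the neighbour. -/
def flow (T : Field) (s : Node) : Node := (s.1 + dir (T s.1 + s.2.exit), .trunk)

/-- The dendrites: every strand is joined to the trunk into which it runs. -/
def dendriteGraph (T : Field) : SimpleGraph Node :=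
  SimpleGraph.fromRel fun s t => flow T s = t

/-- All dendrites are infinite. -/
def DendritesInfinite (T : Field) : Prop :=
  ∀ D : (dendriteGraph T).ConnectedComponent, D.supp.Infinite

/-- A source: a cell, and which of the two sources of the subtile on it. -/
abbrev Source : Type := Cell × Bool

/-- The strand that starts at a source. -/
def Source.node (s : Source) : Node := (s.1, if s.2 then .sourceA else .sourceB)

/-- The path that starts at the source `s` joins the path that starts with the strand `e` of
the subtile at the centre `0`. -/
def GoesTo (T : Field) (s : Source) (e : Strand) : Prop :=
  ∃ m n : ℕ, (flow T)^[m] (Source.node s) = (flow T)^[n] ((0, e) : Node)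

end HexSeed

/-! The rule is contracting: a cell lies in the copy of the monotile that replaces a subtile about
four times closer to the origin. Hence its iterates converge, a fixed point is determined by its
subtile at the origin, and the base `4` digits of a cell drive a finite automaton that computes the
subtile on it.

All that has to be inspected on the monotile itself is how its subtiles meet along the sides of the
enlarged hexagons, and how the paths run inside it. Every strand of a subtile becomes four
consecutive strands in the same direction, and every path soon runs into such an enlarged strand.
Hence a cycle of length `L` in the refined tiling comes from a cycle of length `L / 4`, and likewise
a period of the refined tiling is four times a period of the original one. In a tiling built by the
rule this can be repeated for ever, so there are no cycles and no periods. In a fixed point it pulls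
every path back to the neighbourhood of the origin, where it joins one of the three central
paths. -/

namespace HexSeed

/-! ### The hexagonal grid -/

/-- The distance of a cell from the cell `0` in the hexagonal grid, used to measure how the rule
contracts towards `0`. -/
def hexNorm (x : Cell) : ℕ := max (max x.1.natAbs x.2.natAbs) (x.1 + x.2).natAbs

theorem hexNorm_eq_zero {x : Cell} : hexNorm x = 0 ↔ x = 0 := by
  simp only [hexNorm, Prod.ext_iff, Prod.fst_zero, Prod.snd_zero]
  omega

theorem hexNorm_add_le (x y : Cell) : hexNorm (x + y) ≤ hexNorm x + hexNorm y := by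
  refine max_le (max_le ?_ ?_) ?_ <;> simp only [hexNorm, Prod.fst_add, Prod.snd_add] <;> omega

theorem hexNorm_zsmul (n : ℤ) (x : Cell) : hexNorm (n • x) = n.natAbs * hexNorm x := by
  simp only [hexNorm, Prod.smul_fst, Prod.smul_snd, smul_eq_mul, ← mul_add, Int.natAbs_mul,
    Nat.mul_max_mul_left]

theorem hexNorm_nsmul (n : ℕ) (x : Cell) : hexNorm (n • x) = n * hexNorm x := by
  rw [← natCast_zsmul, hexNorm_zsmul, Int.natAbs_natCast]

theorem hexNorm_four_smul (x : Cell) : hexNorm ((4 : ℤ) • x) = 4 * hexNorm x := hexNorm_zsmul 4 x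

theorem hexNorm_dir : ∀ d, hexNorm (dir d) = 1 := by decide

theorem dir_injective : Function.Injective dir := by decide

theorem dir_add_three : ∀ d, dir (d + 3) = -dir d := by decide

theorem mem_Icc_of_hexNorm_le_one {x : Cell} (hx : hexNorm x ≤ 1) :
    x ∈ Finset.Icc (-1 : Cell) 1 := by
  simp only [hexNorm, Finset.mem_Icc, Prod.le_def, Prod.fst_neg, Prod.snd_neg, Prod.fst_one,
    Prod.snd_one] at *
  omega

theorem exists_dir_of_hexNorm_eq_one {x : Cell} (hx : hexNorm x = 1) : ∃ d, x = dir d := by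
  have near : ∀ y ∈ Finset.Icc (-1 : Cell) 1, hexNorm y = 1 → ∃ d, y = dir d := by decide
  exact near x (mem_Icc_of_hexNorm_le_one hx.le) hx

theorem nsmul_dir_inj {m n : ℕ} (hm : m ≠ 0) {d d' : ZMod 6} (h : m • dir d = n • dir d') :
    d = d' := by
  have hmn : m = n := by simpa only [hexNorm_nsmul, hexNorm_dir, mul_one] using congrArg hexNorm h
  subst hmn
  exact dir_injective (nsmul_right_injective hm h)

theorem centre_add (x y : Cell) : centre (x + y) = centre x + centre y := by
  simp only [centre, Prod.fst_add, Prod.snd_add, Int.cast_add]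
  ring

theorem centre_injective : Function.Injective centre := by
  intro x y h
  have hω : (Complex.exp (Complex.I * (Real.pi / 3))).im ≠ 0 := by
    rw [mul_comm, ← Complex.ofReal_ofNat, ← Complex.ofReal_div, Complex.exp_ofReal_mul_I_im,
      Real.sin_pi_div_three]
    positivity
  have h2 : x.2 = y.2 := by
    have him := congrArg Complex.im h
    simp only [centre, Complex.add_im, Complex.mul_im, Complex.intCast_im, Complex.intCast_re,
      zero_mul, zero_add, add_zero] at him
    exact_mod_cast mul_right_cancel₀ hω him
  refine Prod.ext ?_ h2
  rw [centre, centre, h2] at h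
  exact_mod_cast add_right_cancel h

/-! ### The rule -/

instance (k d : ZMod 6) : Decidable (IsBump k d) := by
  unfold IsBump; infer_instance

theorem hexNorm_rot_le_two : ∀ k, ∀ p ∈ monotile, hexNorm (rot k p.1) ≤ 2 := by
  decide +kernel

theorem exists_eq_smul_add_digits (y : Cell) :
    ∃ x : Cell, ∃ r ∈ Finset.Icc (0 : Cell) 3, y = (4 : ℤ) • x + r := by
  refine ⟨(y.1 / 4, y.2 / 4), (y.1 % 4, y.2 % 4), ?_, ?_⟩
  · simp only [Finset.mem_Icc, Prod.le_def, Prod.fst_zero, Prod.snd_zero, Prod.fst_ofNat,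
      Prod.snd_ofNat]
    omega
  · ext <;> simp only [Prod.fst_add, Prod.snd_add, Prod.smul_fst, Prod.smul_snd, smul_eq_mul] <;>
      omega

theorem exists_monotile_of_isBump : ∀ k d, IsBump k d →
    ∀ i ∈ Finset.Icc 1 2, ∃ p ∈ monotile, rot k p.1 = i • dir d ∧ k + p.2 + 3 = d := by
  decide +kernel

theorem isBump_of_rot_eq_two_nsmul_dir :
    ∀ k d, ∀ p ∈ monotile, rot k p.1 = 2 • dir d → IsBump k d := by
  decide +kernel

theorem monotile_eq_of_rot_eq :
    ∀ k, ∀ p ∈ monotile, ∀ p' ∈ monotile, rot k p.1 = rot k p'.1 → p = p' := by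
  decide +kernel

theorem forall_exists_monotile_or_midpoint (y : Cell) : ∃ x : Cell,
    (∀ k, ∃ p ∈ monotile, y = (4 : ℤ) • x + rot k p.1) ∨ ∃ d, y = (4 : ℤ) • x + 2 • dir d := by
  have digits : ∀ r ∈ Finset.Icc (0 : Cell) 3, ∃ o ∈ Finset.Icc (0 : Cell) 1,
      (∀ k, ∃ p ∈ monotile, r = (4 : ℤ) • o + rot k p.1) ∨ ∃ d, r = (4 : ℤ) • o + 2 • dir d := by
    decide +kernel
  obtain ⟨x, r, hr, rfl⟩ := exists_eq_smul_add_digits y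
  obtain ⟨o, -, h⟩ := digits r hr
  refine ⟨x + o, h.imp (fun h k => ?_) fun ⟨d, hd⟩ => ⟨d, by rw [hd, smul_add, add_assoc]⟩⟩
  obtain ⟨p, hp, hr⟩ := h k
  exact ⟨p, hp, by rw [hr, smul_add, add_assoc]⟩

theorem rot_eq_or_midpoint_of_dvd : ∀ k k', ∀ p ∈ monotile, ∀ p' ∈ monotile,
    (4 : ℤ) ∣ (rot k p.1 - rot k' p'.1).1 → (4 : ℤ) ∣ (rot k p.1 - rot k' p'.1).2 →
      rot k p.1 = rot k' p'.1 ∨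
        ∃ d, rot k p.1 = 2 • dir d ∧ rot k' p'.1 = 2 • dir (d + 3) := by
  decide +kernel

theorem four_smul_add_midpoint (x : Cell) (d : ZMod 6) :
    (4 : ℤ) • (x + dir d) + 2 • dir (d + 3) = (4 : ℤ) • x + 2 • dir d := by
  rw [dir_add_three]
  module

theorem Fits.exists_mem_copy {U : Field} (hU : Fits U) (y : Cell) :
    ∃ x : Cell, ∃ p ∈ monotile, y = (4 : ℤ) • x + rot (U x) p.1 := by
  obtain ⟨x, h | ⟨d, rfl⟩⟩ := forall_exists_monotile_or_midpoint y
  · exact ⟨x, h (U x)⟩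
  by_cases hd : IsBump (U x) d
  · obtain ⟨p, hp, e, -⟩ := exists_monotile_of_isBump _ _ hd 2 (by decide)
    exact ⟨x, p, hp, by rw [e]⟩
  · have hd' : IsBump (U (x + dir d)) (d + 3) := not_not.1 (mt (hU x d).2 hd)
    obtain ⟨p, hp, e, -⟩ := exists_monotile_of_isBump _ _ hd' 2 (by decide)
    exact ⟨x + dir d, p, hp, by rw [e, four_smul_add_midpoint]⟩

theorem Fits.eq_of_mem_copy {U : Field} (hU : Fits U) {x x' : Cell} {p p' : Cell × ZMod 6}
    (hp : p ∈ monotile) (hp' : p' ∈ monotile)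
    (h : (4 : ℤ) • x + rot (U x) p.1 = (4 : ℤ) • x' + rot (U x') p'.1) : x = x' ∧ p = p' := by
  have hsub : rot (U x) p.1 - rot (U x') p'.1 = (4 : ℤ) • (x' - x) := by
    rw [smul_sub, sub_eq_sub_iff_add_eq_add, add_comm, h, add_comm]
  rcases rot_eq_or_midpoint_of_dvd (U x) (U x') p hp p' hp' (by rw [hsub]; exact ⟨_, rfl⟩)
    (by rw [hsub]; exact ⟨_, rfl⟩) with heq | ⟨d, hd, hd'⟩
  · rw [heq, add_left_inj] at h
    obtain rfl := smul_right_injective Cell (by norm_num : (4 : ℤ) ≠ 0) h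
    exact ⟨rfl, monotile_eq_of_rot_eq _ p hp p' hp' heq⟩
  · rw [hd, hd', ← four_smul_add_midpoint, add_left_inj] at h
    obtain rfl := smul_right_injective Cell (by norm_num : (4 : ℤ) ≠ 0) h
    exact absurd (isBump_of_rot_eq_two_nsmul_dir _ _ p' hp' hd')
      ((hU x d).1 (isBump_of_rot_eq_two_nsmul_dir _ _ p hp hd))

theorem monotile_edge_fits : ∀ k, ∀ p ∈ monotile, ∀ d,
    (∃ q ∈ monotile, rot k p.1 + dir d = rot k q.1 ∧
      (IsBump (k + p.2) d ↔ ¬ IsBump (k + q.2) (d + 3))) ∨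
    ∃ d', ∀ k', (IsBump k d' ↔ ¬ IsBump k' (d' + 3)) →
      ∃ q ∈ monotile, rot k p.1 + dir d = (4 : ℤ) • dir d' + rot k' q.1 ∧
        (IsBump (k + p.2) d ↔ ¬ IsBump (k' + q.2) (d + 3)) := by
  decide +kernel

theorem Fits.rule_iff {U T : Field} (hU : Fits U) : Rule U T ↔
    ∀ x, ∀ p ∈ monotile, T ((4 : ℤ) • x + rot (U x) p.1) = U x + p.2 := by
  refine ⟨fun h x p hp => h.2.2.1 _ ⟨x, rfl⟩ (_, _) ⟨p, hp, rfl⟩, fun hT => ⟨hU, ?_, ?_, ?_⟩⟩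
  · intro y d
    obtain ⟨x, p, hp, rfl⟩ := hU.exists_mem_copy y
    rw [hT x p hp, add_assoc]
    rcases monotile_edge_fits (U x) p hp d with ⟨q, hq, e, hfit⟩ | ⟨d', h⟩
    · rwa [e, hT x q hq]
    · obtain ⟨q, hq, e, hfit⟩ := h _ (hU x d')
      rwa [e, ← add_assoc, ← smul_add, hT _ q hq]
  · rintro _ ⟨x, rfl⟩ _ ⟨p, hp, rfl⟩
    exact hT x p hp
  · intro y
    obtain ⟨x, p, hp, rfl⟩ := hU.exists_mem_copy y
    refine ⟨((4 : ℤ) • x, U x), ⟨⟨x, rfl⟩, _, ⟨p, hp, rfl⟩, rfl⟩, ?_⟩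
    rintro _ ⟨⟨x', rfl⟩, _, ⟨q, hq, rfl⟩, h⟩
    obtain ⟨rfl, -⟩ := hU.eq_of_mem_copy hq hp h
    rfl

theorem Fits.exists_rule {U : Field} (hU : Fits U) : ∃ T, Rule U T := by
  choose X p hp hy using hU.exists_mem_copy
  refine ⟨fun y => U (X y) + (p y).2, hU.rule_iff.2 fun x q hq => ?_⟩
  obtain ⟨hx, hq⟩ := hU.eq_of_mem_copy hq (hp _) (hy ((4 : ℤ) • x + rot (U x) q.1))
  rw [← hx, ← hq]

namespace Rule

variable {U T : Field}

theorem fits (h : Rule U T) : Fits T := h.2.1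

theorem apply_mem_copy (h : Rule U T) (x : Cell) {p : Cell × ZMod 6} (hp : p ∈ monotile) :
    T ((4 : ℤ) • x + rot (U x) p.1) = U x + p.2 :=
  (Fits.rule_iff h.1).1 h x p hp

theorem apply_four_smul (h : Rule U T) (x : Cell) : T ((4 : ℤ) • x) = U x := by
  have rot_zero : ∀ k, rot k 0 = 0 := by decide
  simpa only [← Prod.zero_eq_mk, rot_zero, add_zero] using
    h.apply_mem_copy x (p := (0, 0)) (by decide)

theorem exists_mem_copy (h : Rule U T) (y : Cell) : ∃ x, ∃ p ∈ monotile,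
    4 * hexNorm x ≤ hexNorm y + 2 ∧ y = (4 : ℤ) • x + rot (U x) p.1 := by
  obtain ⟨x, p, hp, e⟩ := Fits.exists_mem_copy h.1 y
  refine ⟨x, p, hp, ?_, e⟩
  have hx : (4 : ℤ) • x = y + (-1 : ℤ) • rot (U x) p.1 := by rw [e]; module
  have := hexNorm_add_le y ((-1 : ℤ) • rot (U x) p.1)
  rw [← hx, hexNorm_four_smul, hexNorm_zsmul, Int.natAbs_neg, Int.natAbs_one, one_mul] at this
  exact this.trans (Nat.add_le_add_left (hexNorm_rot_le_two (U x) p hp) _)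

theorem congr_of_hexNorm_le (h : Rule U T) {U' T' : Field} (h' : Rule U' T') {y : Cell}
    (hU : ∀ x, 4 * hexNorm x ≤ hexNorm y + 2 → U x = U' x) : T y = T' y := by
  obtain ⟨x, p, hp, hx, rfl⟩ := h.exists_mem_copy y
  rw [h.apply_mem_copy x hp, hU x hx, h'.apply_mem_copy x hp]

/-! ### Fixed points -/

theorem fixed_unique {P Q : Field} (hP : Rule P P) (hQ : Rule Q Q) (h : P 0 = Q 0) : P = Q := by
  funext y
  induction hn : hexNorm y using Nat.strong_induction_on generalizing y with
  | _ n ih =>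
    rcases Nat.eq_zero_or_pos n with rfl | hpos
    · rw [hexNorm_eq_zero.1 hn, h]
    · exact hP.congr_of_hexNorm_le hQ fun x hx => ih _ (by omega) x rfl

end Rule

theorem Fits.exists_rule_seq {U : Field} (hU : Fits U) :
    ∃ V : ℕ → Field, V 0 = U ∧ ∀ n, Rule (V n) (V (n + 1)) := by
  choose T hT using fun V : {V // Fits V} => V.2.exists_rule
  let V : ℕ → {V // Fits V} := Nat.rec ⟨U, hU⟩ fun _ V => ⟨T V, (hT V).fits⟩
  exact ⟨fun n => (V n).1, rfl, fun n => hT (V n)⟩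

theorem eq_of_rule_seq {V : ℕ → Field} (hV : ∀ n, Rule (V n) (V (n + 1))) {n : ℕ} {y : Cell}
    (hy : hexNorm y ≤ n) : V n y = V (hexNorm y) y := by
  have step : ∀ n y, hexNorm y ≤ n → V (n + 1) y = V n y := by
    intro n
    induction n with
    | zero =>
      intro y hy
      rw [hexNorm_eq_zero.1 (Nat.le_zero.1 hy)]
      simpa using (hV 0).apply_four_smul 0
    | succ n ih => exact fun y hy => (hV _).congr_of_hexNorm_le (hV _) fun x hx => ih x (by omega)
  induction n, hy using Nat.le_induction with
  | base => rfl
  | succ n hn ih => rw [step n y hn, ih]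

theorem Fits.exists_rule_self {U : Field} (hU : Fits U) : ∃ P, Rule P P ∧ P 0 = U 0 := by
  obtain ⟨V, rfl, hV⟩ := hU.exists_rule_seq
  let P : Field := fun y => V (hexNorm y) y
  have hP : ∀ {n y}, hexNorm y ≤ n → P y = V n y := fun hy => (eq_of_rule_seq hV hy).symm
  have hfit : Fits P := by
    intro x d
    rw [hP (le_max_left (hexNorm x) (hexNorm (x + dir d))),
      hP (le_max_right (hexNorm x) (hexNorm (x + dir d)))]
    exact (hV _).1 x d
  refine ⟨P, hfit.rule_iff.2 fun x p hp => ?_, rfl⟩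
  obtain ⟨n, hx, hy⟩ : ∃ n, hexNorm x ≤ n ∧ hexNorm ((4 : ℤ) • x + rot (P x) p.1) ≤ n :=
    ⟨_, le_max_left _ _, le_max_right _ _⟩
  have := (hV n).apply_mem_copy x hp
  rwa [← hP hx, ← hP (hy.trans n.le_succ)] at this

/-- A periodic tiling with the subtile at `0` in orientation `k`, whose images under the rule
converge to a fixed point. In it a step in one of the directions `0°, 120°, 240°` turns the subtile
by `120°`, counterclockwise for even `k` and clockwise for odd `k`. -/
def seed (k : ZMod 6) : Field := fun x => k + (-1) ^ k.val * 2 * (x.1 - x.2)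

theorem fits_seed (k : ZMod 6) : Fits (seed k) := by
  have edge : ∀ k t d : ZMod 6, IsBump (k + (-1) ^ k.val * 2 * t) d ↔
      ¬ IsBump (k + (-1) ^ k.val * 2 * (t + ((dir d).1 - (dir d).2))) (d + 3) := by decide +kernel
  intro x d
  rw [seed, edge, seed, Prod.fst_add, Prod.snd_add, Int.cast_add, Int.cast_add,
    add_sub_add_comm]

theorem existsUnique_rule_self (k : ZMod 6) : ∃! P, Rule P P ∧ P 0 = k := by
  obtain ⟨P, hP, h0⟩ := (fits_seed k).exists_rule_self
  replace h0 : P 0 = k := by simpa [seed] using h0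
  exact ⟨P, ⟨hP, h0⟩, fun Q hQ => hQ.1.fixed_unique hP (hQ.2.trans h0.symm)⟩

theorem Rule.ruleIter_self {P : Field} (h : Rule P P) : ∀ n, RuleIter n P P
  | 0 => rfl
  | n + 1 => ⟨P, h.ruleIter_self n, h⟩

theorem Rule.builtByRule_self {P : Field} (h : Rule P P) : BuiltByRule P :=
  fun n => ⟨0, P, by simpa only [add_zero] using h.ruleIter_self n⟩

/-! ### Orbits of a map -/

section Orbits

variable {α β : Type*} {f : α → α} {x y z : α}

theorem iterate_injective_of_periodicPts_eq_empty (hf : Function.periodicPts f = ∅) (x : α) :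
    Function.Injective fun n => f^[n] x := by
  have ne_of_lt : ∀ {m n}, m < n → f^[m] x ≠ f^[n] x := by
    intro m n hmn h
    have hper : Function.IsPeriodicPt f (n - m) (f^[m] x) := by
      rw [Function.IsPeriodicPt, Function.IsFixedPt, ← Function.iterate_add_apply,
        Nat.sub_add_cancel hmn.le, h]
    exact hf.le (Function.mk_mem_periodicPts (Nat.sub_pos_of_lt hmn) hper)
  intro m n h
  rcases lt_trichotomy m n with hmn | hmn | hmn
  exacts [(ne_of_lt hmn h).elim, hmn, (ne_of_lt hmn h.symm).elim]

/-- The graph of a self-map as an undirected graph: every point is joined to its image. It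
generalizes `dendriteGraph`. -/
abbrev functionalGraph (f : α → α) : SimpleGraph α := SimpleGraph.fromRel fun x y => f x = y

theorem functionalGraph_reachable_iterate (f : α → α) (x : α) (n : ℕ) :
    (functionalGraph f).Reachable x (f^[n] x) := by
  induction n with
  | zero => rfl
  | succ n ih =>
    rw [Function.iterate_succ_apply']
    by_cases h : f^[n] x = f (f^[n] x)
    · rwa [← h]
    · exact ih.trans (SimpleGraph.Adj.reachable ⟨h, Or.inl rfl⟩)

theorem functionalGraph_infinite_supp (hf : Function.periodicPts f = ∅)
    (D : (functionalGraph f).ConnectedComponent) : D.supp.Infinite := by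
  induction D using SimpleGraph.ConnectedComponent.ind with | _ x
  exact Set.infinite_of_injective_forall_mem (iterate_injective_of_periodicPts_eq_empty hf x)
    fun n => SimpleGraph.ConnectedComponent.sound (functionalGraph_reachable_iterate f x n).symm

/-- The points whose orbit contains `x` form a union of components once the edge from `x` to `f x`
is deleted. Since `f x` is not among them, that edge is a bridge. -/
theorem functionalGraph_isBridge (hf : Function.periodicPts f = ∅) (x : α) :
    (functionalGraph f).IsBridge s(x, f x) := by
  rw [SimpleGraph.isBridge_iff]
  intro hreach
  have mem_orbit : ∀ y, ((functionalGraph f).deleteEdges {s(x, f x)}).Reachable x y →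
      ∃ n, f^[n] y = x := by
    intro y hy
    rw [SimpleGraph.reachable_iff_reflTransGen] at hy
    induction hy with
    | refl => exact ⟨0, rfl⟩
    | @tail a b _ hab ih =>
      obtain ⟨n, hn⟩ := ih
      rw [SimpleGraph.deleteEdges_adj] at hab
      rcases hab.1.2 with rfl | rfl
      · cases n with
        | zero =>
          obtain rfl : a = x := hn
          exact absurd rfl hab.2
        | succ n => exact ⟨n, hn⟩
      · exact ⟨n + 1, hn⟩
  obtain ⟨n, hn⟩ := mem_orbit _ hreach
  exact hf.le (Function.mk_mem_periodicPts n.succ_pos hn)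

theorem functionalGraph_isAcyclic (hf : Function.periodicPts f = ∅) :
    (functionalGraph f).IsAcyclic := by
  rw [SimpleGraph.isAcyclic_iff_forall_isBridge]
  intro e he
  induction e with | _ x y
  rw [SimpleGraph.mem_edgeSet, SimpleGraph.fromRel_adj] at he
  rcases he.2 with rfl | rfl
  · exact functionalGraph_isBridge hf x
  · rw [Sym2.eq_swap]
    exact functionalGraph_isBridge hf y

/-- The orbits of two points under iteration of `f` have a point in common. -/
def OrbitsMeet (f : α → α) (x y : α) : Prop := ∃ m n, f^[m] x = f^[n] y

theorem orbitsMeet_iterate (f : α → α) (x : α) (n : ℕ) : OrbitsMeet f x (f^[n] x) := ⟨n, 0, rfl⟩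

theorem OrbitsMeet.symm (h : OrbitsMeet f x y) : OrbitsMeet f y x := by
  obtain ⟨m, n, h⟩ := h
  exact ⟨n, m, h.symm⟩

theorem OrbitsMeet.trans (h : OrbitsMeet f x y) (h' : OrbitsMeet f y z) : OrbitsMeet f x z := by
  obtain ⟨m, n, h⟩ := h
  obtain ⟨i, j, h'⟩ := h'
  refine ⟨i + m, n + j, ?_⟩
  rw [Function.iterate_add_apply, h, ← Function.iterate_add_apply, add_comm i,
    Function.iterate_add_apply, h', ← Function.iterate_add_apply]

theorem orbitsMeet_iterate_iff (n : ℕ) : OrbitsMeet f (f^[n] x) y ↔ OrbitsMeet f x y :=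
  ⟨(orbitsMeet_iterate f x n).trans, (orbitsMeet_iterate f x n).symm.trans⟩

theorem OrbitsMeet.map {g : β → β} {φ : α → β} {N : ℕ} (hφ : Function.Semiconj φ f g^[N])
    (h : OrbitsMeet f x y) : OrbitsMeet g (φ x) (φ y) := by
  obtain ⟨m, n, h⟩ := h
  refine ⟨N * m, N * n, ?_⟩
  rw [Function.iterate_mul, Function.iterate_mul, ← (hφ.iterate_right m).eq,
    ← (hφ.iterate_right n).eq, h]

end Orbits

/-! ### Paths and the rule -/

theorem isBump_iff {k d : ZMod 6} : IsBump k d ↔ ∃ e : Strand, k + e.exit = d := by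
  have exits : ∀ k d : ZMod 6, IsBump k d ↔ k + 3 = d ∨ k + 1 = d ∨ k + 4 = d := by decide
  rw [exits]
  constructor
  · rintro (h | h | h)
    exacts [⟨.trunk, h⟩, ⟨.sourceA, h⟩, ⟨.sourceB, h⟩]
  · rintro ⟨_ | _ | _, h⟩
    exacts [Or.inl h, Or.inr (Or.inl h), Or.inr (Or.inr h)]

theorem isBump_add_exit (k : ZMod 6) (e : Strand) : IsBump k (k + e.exit) := isBump_iff.2 ⟨e, rfl⟩

theorem hexNorm_flow_iterate_sub_le (T : Field) (n : ℕ) (s : Node) :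
    hexNorm (((flow T)^[n] s).1 - s.1) ≤ n := by
  induction n with
  | zero => simp [hexNorm]
  | succ n ih =>
    rw [Function.iterate_succ_apply', flow, add_sub_right_comm]
    exact (hexNorm_add_le _ _).trans (by rw [hexNorm_dir]; omega)

theorem flow_iterate_straight {T : Field} {c : Cell} {e : Strand} {d : ZMod 6}
    (h0 : T c + e.exit = d) {n : ℕ} (h : ∀ i, 0 < i → i < n → T (c + i • dir d) + 3 = d)
    (hn : 0 < n) : (flow T)^[n] (c, e) = (c + n • dir d, .trunk) := by
  induction n, hn using Nat.le_induction with
  | base => simp [flow, h0]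
  | succ n hn ih =>
    rw [Function.iterate_succ_apply', ih fun i h0 hi => h i h0 (hi.trans n.lt_succ_self)]
    simp only [flow, Strand.exit]
    rw [h n hn n.lt_succ_self, succ_nsmul, add_assoc]

/-- The node of the refined tiling at which the enlarged copy of a strand starts. -/
def scale (s : Node) : Node := ((4 : ℤ) • s.1, s.2)

theorem scale_injective : Function.Injective scale := by
  rintro ⟨x, e⟩ ⟨y, e'⟩ h
  obtain ⟨hxy, he⟩ := Prod.mk.inj h
  exact Prod.ext (smul_right_injective Cell (by norm_num : (4 : ℤ) ≠ 0) hxy) he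

theorem exists_monotile_of_not_isBump : ∀ k d, ¬ IsBump k (d + 3) →
    ∃ p ∈ monotile, (4 : ℤ) • dir d + rot k p.1 = 3 • dir d ∧ k + p.2 + 3 = d := by
  decide +kernel

theorem monotile_trunk_cases : ∀ k, ∀ p ∈ monotile,
    rot k p.1 = 0 ∨ rot k p.1 + dir (k + p.2 + 3) = 0 ∨
    (∃ d, IsBump k d ∧ ∃ j ∈ Finset.Icc 1 2, rot k p.1 = j • dir d) ∨
    ∃ d, rot k p.1 + dir (k + p.2 + 3) = 2 • dir d := by
  decide +kernel

namespace Rule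

variable {U T : Field}

theorem trunk_on_strand (h : Rule U T) (x : Cell) {d : ZMod 6} (hd : IsBump (U x) d) {i : ℕ}
    (h0 : 0 < i) (h4 : i < 4) : T ((4 : ℤ) • x + i • dir d) + 3 = d := by
  rcases Nat.lt_or_ge i 3 with h3 | h3
  · obtain ⟨p, hp, e, ht⟩ := exists_monotile_of_isBump _ _ hd i (Finset.mem_Icc.2 (by omega))
    rw [← e, h.apply_mem_copy x hp, ht]
  · obtain rfl : i = 3 := by omega
    obtain ⟨p, hp, e, ht⟩ := exists_monotile_of_not_isBump _ _ ((h.1 x d).1 hd)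
    rw [← e, ← add_assoc, ← smul_add, h.apply_mem_copy _ hp, ht]

theorem flow_iterate_scale_of_le (h : Rule U T) (x : Cell) (e : Strand) {j : ℕ} (hj : 0 < j)
    (hj4 : j ≤ 4) :
    (flow T)^[j] (scale (x, e)) = ((4 : ℤ) • x + j • dir (U x + e.exit), .trunk) :=
  flow_iterate_straight (by rw [h.apply_four_smul])
    (fun _ h0 hi => h.trunk_on_strand x (isBump_add_exit _ e) h0 (hi.trans_le hj4)) hj

theorem semiconj_scale (h : Rule U T) : Function.Semiconj scale (flow U) (flow T)^[4] := by
  rintro ⟨x, e⟩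
  rw [h.flow_iterate_scale_of_le x e (by norm_num) le_rfl, scale, flow, smul_add,
    ← natCast_zsmul, Nat.cast_ofNat]

theorem flow_iterate_to_end (h : Rule U T) (x : Cell) {d : ZMod 6} (hd : IsBump (U x) d) {j : ℕ}
    (hj : 0 < j) (hj4 : j ≤ 4) :
    (flow T)^[4 - j] ((4 : ℤ) • x + j • dir d, .trunk) = scale (x + dir d, .trunk) := by
  obtain ⟨e, rfl⟩ := isBump_iff.1 hd
  rw [← h.flow_iterate_scale_of_le x e hj hj4, ← Function.iterate_add_apply,
    Nat.sub_add_cancel hj4, ← h.semiconj_scale.eq, flow]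

theorem flow_iterate_midpoint (h : Rule U T) (x : Cell) (d : ZMod 6) :
    (flow T)^[2] ((4 : ℤ) • x + 2 • dir d, .trunk) =
      scale (x + if IsBump (U x) d then dir d else 0, .trunk) := by
  split_ifs with hd
  · exact h.flow_iterate_to_end x hd (j := 2) (by norm_num) (by norm_num)
  · have hd' : IsBump (U (x + dir d)) (d + 3) := not_not.1 (mt (h.1 x d).2 hd)
    have := h.flow_iterate_to_end (x + dir d) hd' (j := 2) (by norm_num) (by norm_num)
    rw [four_smul_add_midpoint, dir_add_three, add_neg_cancel_right] at this
    rwa [add_zero]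

end Rule

/-- The number `i` of steps and the displacement `o` depend only on the subtile `k` and the position
`p` in its copy of the monotile, so that a finite automaton can follow the paths. -/
theorem exists_iterate_eq_scale_of_mem (k : ZMod 6) {p : Cell × ZMod 6} (hp : p ∈ monotile) :
    ∃ i ≤ 3, ∃ o, hexNorm o ≤ 1 ∧ ∀ {U T : Field}, Rule U T → ∀ {x}, U x = k →
      (flow T)^[i] ((4 : ℤ) • x + rot k p.1, .trunk) = scale (x + o, .trunk) := by
  have hflow : ∀ {U T : Field}, Rule U T → ∀ {x}, U x = k →
      flow T ((4 : ℤ) • x + rot k p.1, .trunk) =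
        ((4 : ℤ) • x + (rot k p.1 + dir (k + p.2 + 3)), .trunk) := by
    rintro U T h x rfl
    rw [flow, h.apply_mem_copy x hp, Strand.exit, add_assoc]
  rcases monotile_trunk_cases k p hp with hc | hc | ⟨d, hd, j, hj, hc⟩ | ⟨d, hc⟩
  · refine ⟨0, by norm_num, 0, by decide, fun _ _ _ => ?_⟩
    rw [hc, Function.iterate_zero_apply, add_zero, add_zero, scale]
  · refine ⟨1, by norm_num, 0, by decide, fun h _ hx => ?_⟩
    rw [Function.iterate_one, hflow h hx, hc, add_zero, add_zero, scale]
  · obtain ⟨h1, h2⟩ := Finset.mem_Icc.1 hj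
    refine ⟨4 - j, by omega, dir d, (hexNorm_dir d).le, fun h x hx => ?_⟩
    rw [hc]
    exact h.flow_iterate_to_end x (hx ▸ hd) h1 (by omega)
  · refine ⟨3, le_rfl, if IsBump k d then dir d else 0, ?_, fun h x hx => ?_⟩
    · split_ifs
      exacts [(hexNorm_dir d).le, by decide]
    · rw [Function.iterate_succ_apply, hflow h hx, hc, h.flow_iterate_midpoint, hx]

theorem Rule.exists_iterate_trunk_eq_scale {U T : Field} (h : Rule U T) (y : Cell) :
    ∃ i z, (flow T)^[i] (y, .trunk) = scale (z, .trunk) ∧ 4 * hexNorm z ≤ hexNorm y + 3 := by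
  obtain ⟨x, p, hp, -, hy⟩ := h.exists_mem_copy y
  obtain ⟨i, hi, o, -, hio⟩ := exists_iterate_eq_scale_of_mem (U x) hp
  have hz : (flow T)^[i] (y, .trunk) = scale (x + o, .trunk) := hy ▸ hio h rfl
  refine ⟨i, x + o, hz, ?_⟩
  have hdisp := hexNorm_flow_iterate_sub_le T i (y, .trunk)
  have hadd := hexNorm_add_le ((4 : ℤ) • (x + o) - y) y
  rw [hz] at hdisp
  rw [sub_add_cancel, hexNorm_four_smul] at hadd
  simp only [scale] at hdisp
  omega

/-! ### Cycles -/

theorem Rule.exists_isPeriodicPt {U T : Field} (h : Rule U T) {L : ℕ} {s : Node}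
    (hs : Function.IsPeriodicPt (flow T) L s) :
    ∃ L' s', L = 4 * L' ∧ Function.IsPeriodicPt (flow U) L' s' := by
  obtain ⟨i, z, hz, -⟩ := h.exists_iterate_trunk_eq_scale (flow T s).1
  have hL : Function.IsPeriodicPt (flow T) L (scale (z, .trunk)) := hz ▸ hs.apply.apply_iterate i
  rw [Function.IsPeriodicPt, Function.IsFixedPt, ← Nat.mod_add_div L 4, Function.iterate_add_apply,
    Function.iterate_mul, ← (h.semiconj_scale.iterate_right _).eq] at hL
  rcases Nat.eq_zero_or_pos (L % 4) with hr | hr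
  · rw [hr] at hL
    exact ⟨_, _, (Nat.mul_div_cancel' (Nat.dvd_of_mod_eq_zero hr)).symm, scale_injective hL⟩
  obtain ⟨⟨w, e⟩, hw⟩ : ∃ t, (flow U)^[L / 4] (z, .trunk) = t := ⟨_, rfl⟩
  rw [hw, h.flow_iterate_scale_of_le w e hr (Nat.mod_lt L (by norm_num)).le] at hL
  have hdir : (L % 4) • dir (U w + e.exit) = (4 : ℤ) • (z - w) := by
    rw [smul_sub, ← (Prod.mk.inj hL).1, add_sub_cancel_left]
  have := congrArg hexNorm hdir
  rw [hexNorm_nsmul, hexNorm_dir, hexNorm_four_smul] at this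
  omega

theorem RuleIter.four_pow_dvd_of_isPeriodicPt {n : ℕ} {U T : Field} (h : RuleIter n U T) {L : ℕ}
    {s : Node} (hs : Function.IsPeriodicPt (flow T) L s) : 4 ^ n ∣ L := by
  induction n generalizing T L s with
  | zero => exact one_dvd L
  | succ n ih =>
    obtain ⟨V, hV, hR⟩ := h
    obtain ⟨L', s', rfl, hs'⟩ := hR.exists_isPeriodicPt hs
    rw [pow_succ']
    exact mul_dvd_mul_left _ (ih hV hs')

theorem semiconj_flow_translate (T : Field) (c : Cell) :
    Function.Semiconj (fun s : Node => (s.1 - c, s.2)) (flow T) (flow fun x => T (x + c)) := by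
  intro s
  simp only [flow, sub_add_cancel, add_sub_right_comm]

theorem BuiltByRule.periodicPts_flow {T : Field} (h : BuiltByRule T) :
    Function.periodicPts (flow T) = ∅ := by
  refine Set.eq_empty_of_forall_notMem fun s ⟨L, hL, hs⟩ => ?_
  obtain ⟨c, U, hU⟩ := h L
  have hdvd := hU.four_pow_dvd_of_isPeriodicPt (hs.map (semiconj_flow_translate T c))
  exact absurd (Nat.le_of_dvd hL hdvd) (not_le.2 (Nat.lt_pow_self (by norm_num)))

/-! ### Periods -/

theorem exists_monotile_shift_ne : ∀ r ∈ Finset.Icc (0 : Cell) 3, r ≠ 0 →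
    ∃ o ∈ Finset.Icc (0 : Cell) 1, ∀ k k', ∃ p ∈ monotile, ∃ p' ∈ monotile,
      r + rot k p.1 = (4 : ℤ) • o + rot k' p'.1 ∧ k + p.2 ≠ k' + p'.2 := by
  decide +kernel

theorem Rule.exists_periodic {U T : Field} (h : Rule U T) {c : Cell}
    (hc : Function.Periodic T c) : ∃ c', c = (4 : ℤ) • c' ∧ Function.Periodic U c' := by
  obtain ⟨z, r, hr, rfl⟩ := exists_eq_smul_add_digits c
  rcases eq_or_ne r 0 with rfl | hr0
  · refine ⟨z, add_zero _, fun x => ?_⟩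
    rw [← h.apply_four_smul, ← h.apply_four_smul, smul_add, ← hc ((4 : ℤ) • x), add_zero]
  · obtain ⟨o, -, hm⟩ := exists_monotile_shift_ne r hr hr0
    obtain ⟨p, hp, p', hp', e, hne⟩ := hm (U 0) (U (z + o))
    refine absurd ?_ hne
    rw [← h.apply_mem_copy 0 hp, ← h.apply_mem_copy _ hp', ← hc, smul_add, add_assoc _ _ (rot _ _),
      ← e]
    congr 1
    module

theorem RuleIter.exists_eq_smul_of_periodic {n : ℕ} {U T : Field} (h : RuleIter n U T) {c : Cell}
    (hc : Function.Periodic T c) : ∃ c', c = (4 : ℤ) ^ n • c' := by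
  induction n generalizing T c with
  | zero => exact ⟨c, by rw [pow_zero, one_smul]⟩
  | succ n ih =>
    obtain ⟨V, hV, hR⟩ := h
    obtain ⟨c', rfl, hc'⟩ := hR.exists_periodic hc
    obtain ⟨c'', rfl⟩ := ih hV hc'
    exact ⟨c'', by rw [pow_succ', mul_smul]⟩

theorem BuiltByRule.eq_zero_of_periodic {T : Field} (h : BuiltByRule T) {c : Cell}
    (hc : Function.Periodic T c) : c = 0 := by
  obtain ⟨b, U, hU⟩ := h (hexNorm c)
  obtain ⟨c', hc'⟩ := hU.exists_eq_smul_of_periodic fun x => by rw [add_right_comm, hc]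
  have hdvd : 4 ^ hexNorm c ∣ hexNorm c := ⟨hexNorm c', by
    exact (congrArg hexNorm hc').trans (by rw [hexNorm_zsmul, Int.natAbs_pow]; rfl)⟩
  exact hexNorm_eq_zero.1 (Nat.eq_zero_of_dvd_of_lt hdvd (Nat.lt_pow_self (by norm_num)))

theorem BuiltByRule.nonperiodic {T : Field} (h : BuiltByRule T) : Nonperiodic T := by
  intro v hv
  have shift : ∀ x, ∃ y, centre y = centre x + v ∧ T y = T x := by
    intro x
    obtain ⟨y, hy⟩ : (centre x + v, T x) ∈ placed T := hv ▸ ⟨_, ⟨x, rfl⟩, rfl⟩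
    exact ⟨y, Prod.mk.inj hy⟩
  have h0 : centre 0 = 0 := by simp [centre]
  obtain ⟨c, hc, -⟩ := shift 0
  rw [h0, zero_add] at hc
  have hper : Function.Periodic T c := fun x => by
    obtain ⟨y, hy, hT⟩ := shift x
    rw [← hc, ← centre_add] at hy
    rw [← centre_injective hy, hT]
  rw [← hc, h.eq_zero_of_periodic hper, h0]

/-! ### The central paths of a fixed point -/

theorem Strand.exit_injective : Function.Injective Strand.exit := by
  rintro (_ | _ | _) (_ | _ | _) h <;> first | rfl | exact absurd h (by decide)

/-- The distance of a cell from the line through `0` at angle `60° * k`, in units of the distance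
between neighbouring parallel rows of cells, with positive sign to the left of the line. -/
def height (k : ZMod 6) : Cell →+ ℤ :=
  AddMonoidHom.mk' (fun x => (dir k).1 * x.2 - (dir k).2 * x.1) fun x y => by
    simp only [Prod.fst_add, Prod.snd_add]
    ring

theorem height_apply (k : ZMod 6) (x : Cell) :
    height k x = (dir k).1 * x.2 - (dir k).2 * x.1 := rfl

theorem height_zero (x : Cell) : height 0 x = x.2 := by
  simp [height_apply, dir, rot]

theorem abs_height_dir_le_one : ∀ k d, |height k (dir d)| ≤ 1 := by decide

theorem exists_eq_zsmul_dir_of_height_eq_zero {k : ZMod 6} {x : Cell} (hx : height k x = 0) :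
    ∃ n : ℤ, x = n • dir k := by
  have bezout : ∀ k, ∃ a ∈ Finset.Icc (-1 : Cell) 1,
      a.1 * (dir k).1 + a.2 * (dir k).2 = 1 := by decide
  obtain ⟨a, -, ha⟩ := bezout k
  refine ⟨a.1 * x.1 + a.2 * x.2, Prod.ext ?_ ?_⟩ <;>
    simp only [height_apply, Prod.smul_fst, Prod.smul_snd, smul_eq_mul] at *
  · linear_combination -x.1 * ha - a.2 * hx
  · linear_combination -x.2 * ha + a.1 * hx

theorem pos_iff_pos_zero_of_abs_sub_le_one {a : ℕ → ℤ} (hstep : ∀ n, |a (n + 1) - a n| ≤ 1)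
    (hne : ∀ n, a n ≠ 0) (n : ℕ) : 0 < a n ↔ 0 < a 0 := by
  induction n with
  | zero => rfl
  | succ n ih =>
    rw [← ih]
    have := abs_le.1 (hstep n)
    have := hne n
    have := hne (n + 1)
    omega

namespace Rule

variable {P : Field} {d : ZMod 6}

theorem apply_nsmul_dir_of_isBump (h : Rule P P) (hd : IsBump (P 0) d) {n : ℕ} (hn : 0 < n) :
    P (n • dir d) + 3 = d := by
  induction n using Nat.strong_induction_on with | _ n ih
  have hbump : IsBump (P ((n / 4) • dir d)) d := by
    rcases Nat.eq_zero_or_pos (n / 4) with h0 | h0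
    · rwa [h0, zero_smul]
    · exact isBump_iff.2 ⟨.trunk, ih _ (by omega) h0⟩
  have hsplit : n • dir d = (4 : ℤ) • (n / 4) • dir d + (n % 4) • dir d := by
    rw [← natCast_zsmul (dir d) (n / 4), smul_smul, ← natCast_zsmul, ← natCast_zsmul, ← add_smul]
    congr 1
    omega
  rw [hsplit]
  rcases Nat.eq_zero_or_pos (n % 4) with hr | hr
  · rw [hr, zero_smul, add_zero, h.apply_four_smul]
    exact ih _ (by omega) (by omega)
  · exact h.trunk_on_strand _ hbump hr (Nat.mod_lt _ (by norm_num))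

theorem apply_nsmul_dir_of_not_isBump (h : Rule P P) (hd : ¬ IsBump (P 0) d) {n : ℕ}
    (hn : 0 < n) : P (n • dir d) = d := by
  induction n using Nat.strong_induction_on with | _ n ih
  obtain ⟨m, j, hj, rfl⟩ : ∃ m j, j < 4 ∧ n = 4 * m - j :=
    ⟨(n + 3) / 4, (4 - n % 4) % 4, by omega, by omega⟩
  have hbump : IsBump (P (m • dir d)) (d + 3) := by
    rcases Nat.lt_or_ge 1 m with hm | hm
    · exact isBump_iff.2 ⟨.trunk, by rw [ih m (by omega) (by omega), Strand.exit]⟩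
    · obtain rfl : m = 1 := by omega
      rw [one_smul, ← zero_add (dir d)]
      exact not_not.1 (mt (h.1 0 d).2 hd)
  have hsplit : (4 * m - j) • dir d = (4 : ℤ) • m • dir d + j • dir (d + 3) := by
    rw [dir_add_three, smul_neg, ← sub_eq_add_neg, eq_sub_iff_add_eq, ← add_smul,
      Nat.sub_add_cancel (by omega), mul_smul, ← natCast_zsmul _ 4, Nat.cast_ofNat]
  rw [hsplit]
  rcases Nat.eq_zero_or_pos j with rfl | hj0
  · rw [zero_smul, add_zero, h.apply_four_smul]
    exact ih _ (by omega) (by omega)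
  · exact add_right_cancel (h.trunk_on_strand _ hbump hj0 hj)

theorem flow_iterate_centre (h : Rule P P) (e : Strand) {n : ℕ} (hn : 0 < n) :
    (flow P)^[n] (0, e) = (n • dir (P 0 + e.exit), .trunk) := by
  rw [flow_iterate_straight rfl (fun i hi _ => ?_) hn, zero_add]
  rw [zero_add]
  exact h.apply_nsmul_dir_of_isBump (isBump_add_exit _ e) hi

theorem flow_iterate_centre_fst (h : Rule P P) (e : Strand) (n : ℕ) :
    ((flow P)^[n] (0, e)).1 = n • dir (P 0 + e.exit) := by
  rcases Nat.eq_zero_or_pos n with rfl | hn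
  · rw [zero_smul, Function.iterate_zero_apply]
  · rw [h.flow_iterate_centre e hn]

theorem flow_iterate_nsmul_dir (h : Rule P P) (hd : ¬ IsBump (P 0) d) (n : ℕ) :
    (flow P)^[n] (n • dir d, .trunk) = (0, .trunk) := by
  induction n with
  | zero => rw [zero_smul, Function.iterate_zero_apply]
  | succ n ih =>
    rw [Function.iterate_succ_apply, flow, h.apply_nsmul_dir_of_not_isBump hd n.succ_pos,
      Strand.exit, dir_add_three, succ_nsmul, add_neg_cancel_right, ih]

theorem orbitsMeet_scale (h : Rule P P) {s : Node} {e : Strand}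
    (hs : OrbitsMeet (flow P) s (0, e)) : OrbitsMeet (flow P) (scale s) (0, e) :=
  hs.map h.semiconj_scale

theorem exists_orbitsMeet_trunk (h : Rule P P) (y : Cell) :
    ∃ e, OrbitsMeet (flow P) (y, .trunk) (0, e) := by
  induction hn : hexNorm y using Nat.strong_induction_on generalizing y with | _ n ih
  match n with
  | 0 => exact ⟨.trunk, by rw [hexNorm_eq_zero.1 hn]; exact orbitsMeet_iterate _ _ 0⟩
  | 1 =>
    obtain ⟨d, rfl⟩ := exists_dir_of_hexNorm_eq_one hn
    by_cases hd : IsBump (P 0) d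
    · obtain ⟨e, rfl⟩ := isBump_iff.1 hd
      refine ⟨e, OrbitsMeet.symm ?_⟩
      rw [← one_smul ℕ (dir _), ← h.flow_iterate_centre e one_pos]
      exact orbitsMeet_iterate _ _ 1
    · refine ⟨.trunk, ?_⟩
      rw [← one_smul ℕ (dir _), ← h.flow_iterate_nsmul_dir hd 1]
      exact orbitsMeet_iterate _ _ 1
  | n + 2 =>
    obtain ⟨i, z, hz, hlt⟩ := h.exists_iterate_trunk_eq_scale y
    obtain ⟨e, he⟩ := ih (hexNorm z) (by omega) z rfl
    exact ⟨e, (hz ▸ orbitsMeet_iterate _ _ i).trans (h.orbitsMeet_scale he)⟩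

theorem eq_of_orbitsMeet_centre (h : Rule P P) {e e' : Strand}
    (he : OrbitsMeet (flow P) (0, e) (0, e')) : e = e' := by
  obtain ⟨m, n, hmn⟩ := he
  replace hmn := congrArg (flow P) hmn
  rw [← Function.iterate_succ_apply' (flow P), ← Function.iterate_succ_apply' (flow P),
    h.flow_iterate_centre e m.succ_pos, h.flow_iterate_centre e' n.succ_pos] at hmn
  exact Strand.exit_injective (add_left_cancel (nsmul_dir_inj m.succ_ne_zero (Prod.mk.inj hmn).1))

theorem existsUnique_orbitsMeet (h : Rule P P) (s : Node) :
    ∃! e, OrbitsMeet (flow P) s (0, e) := by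
  obtain ⟨e, he⟩ := h.exists_orbitsMeet_trunk (flow P s).1
  have hs : OrbitsMeet (flow P) s (0, e) := (orbitsMeet_iterate (flow P) s 1).trans he
  exact ⟨e, hs, fun e' he' => h.eq_of_orbitsMeet_centre (he'.symm.trans hs)⟩

theorem orbitsMeet_scale_iff (h : Rule P P) {s : Node} {e : Strand} :
    OrbitsMeet (flow P) (scale s) (0, e) ↔ OrbitsMeet (flow P) s (0, e) := by
  refine ⟨fun hs => ?_, h.orbitsMeet_scale⟩
  obtain ⟨e', he', -⟩ := h.existsUnique_orbitsMeet s
  rwa [(h.existsUnique_orbitsMeet (scale s)).unique hs (h.orbitsMeet_scale he')]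

theorem orbitsMeet_trunk_of_height_eq_zero (h : Rule P P) {y : Cell} (hy : height (P 0) y = 0) :
    OrbitsMeet (flow P) (y, .trunk) (0, .trunk) := by
  have hole : ∀ k, ¬ IsBump k k := by decide
  obtain ⟨n, rfl⟩ := exists_eq_zsmul_dir_of_height_eq_zero hy
  obtain ⟨n, rfl | rfl⟩ := n.eq_nat_or_neg
  · rw [natCast_zsmul, ← h.flow_iterate_nsmul_dir (hole _) n]
    exact orbitsMeet_iterate _ _ n
  · rcases Nat.eq_zero_or_pos n with rfl | hn
    · exact ⟨0, 0, by simp⟩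
    · rw [neg_smul, natCast_zsmul, ← smul_neg, ← dir_add_three,
        ← show Strand.exit .trunk = 3 from rfl, ← h.flow_iterate_centre .trunk hn]
      exact (orbitsMeet_iterate _ _ n).symm

theorem height_flow_iterate_ne_zero (h : Rule P P) {s : Node} {e : Strand} (he : e ≠ .trunk)
    (hs : OrbitsMeet (flow P) s (0, e)) (n : ℕ) :
    height (P 0) ((flow P)^[n + 1] s).1 ≠ 0 := by
  intro h0
  have hn : (flow P)^[n + 1] s = (((flow P)^[n + 1] s).1, .trunk) := by
    rw [Function.iterate_succ_apply', flow]
  have htrunk := (hn ▸ orbitsMeet_iterate (flow P) s (n + 1)).trans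
    (h.orbitsMeet_trunk_of_height_eq_zero h0)
  exact he ((h.existsUnique_orbitsMeet s).unique hs htrunk)

theorem height_flow_pos_iff (h : Rule P P) {s : Node} {e : Strand} (he : e ≠ .trunk)
    (hs : OrbitsMeet (flow P) s (0, e)) :
    0 < height (P 0) (flow P s).1 ↔ 0 < height (P 0) (dir (P 0 + e.exit)) := by
  have hstep : ∀ n, |height (P 0) ((flow P)^[n + 1 + 1] s).1 -
      height (P 0) ((flow P)^[n + 1] s).1| ≤ 1 := by
    intro n
    rw [Function.iterate_succ_apply' _ (n + 1), ← map_sub, flow, add_sub_cancel_left]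
    exact abs_height_dir_le_one _ _
  obtain ⟨m, n, hmn⟩ := id hs
  have hm : (flow P)^[m + 1] s = ((n + 1) • dir (P 0 + e.exit), .trunk) := by
    rw [Function.iterate_succ_apply', hmn, ← Function.iterate_succ_apply' (flow P),
      h.flow_iterate_centre e n.succ_pos]
  have hpos : 0 < height (P 0) ((flow P)^[m + 1] s).1 ↔ 0 < height (P 0) (flow P s).1 :=
    pos_iff_pos_zero_of_abs_sub_le_one (a := fun n => height (P 0) ((flow P)^[n + 1] s).1)
      hstep (h.height_flow_iterate_ne_zero he hs) m
  rw [← hpos, hm, map_nsmul, nsmul_pos_iff n.succ_ne_zero]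

theorem height_flow_pos (h : Rule P P) {s : Node} (hs : OrbitsMeet (flow P) s (0, .sourceA)) :
    0 < height (P 0) (flow P s).1 := by
  have hne : Strand.sourceA ≠ .trunk := nofun
  have hdir : ∀ k, 0 < height k (dir (k + 1)) := by decide
  exact (h.height_flow_pos_iff hne hs).2 (hdir _)

theorem height_flow_neg (h : Rule P P) {s : Node} (hs : OrbitsMeet (flow P) s (0, .sourceB)) :
    height (P 0) (flow P s).1 < 0 := by
  have hne : Strand.sourceB ≠ .trunk := nofun
  have hdir : ∀ k, height k (dir (k + 4)) < 0 := by decide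
  refine lt_of_le_of_ne (not_lt.1 ?_) (h.height_flow_iterate_ne_zero hne hs 0)
  rw [h.height_flow_pos_iff hne hs]
  exact (hdir _).not_gt

end Rule

/-! ### Decidability -/

theorem primrec_of_finite_recursion {α β δ : Type*} [Primcodable α] [Primcodable β] [Primcodable δ]
    [Finite β] [Finite δ] {f : α → β} {parent : α → α} {digit : α → δ} {size : α → ℕ}
    (hparent : Primrec parent) (hdigit : Primrec digit) (hsize : Primrec size)
    (hlt : ∀ x, parent x ≠ x → size (parent x) < size x)
    (hbase : ∀ x y, parent x = x → parent y = y → digit x = digit y → f x = f y)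
    (hstep : ∀ x y, digit x = digit y → f (parent x) = f (parent y) → f x = f y) :
    Primrec f := by
  classical
  let parents (x : α) : List α := if parent x = x then [] else [parent x]
  have hparents : Primrec parents :=
    .ite (Primrec.eq.comp hparent .id) (.const []) (Primrec.list_cons.comp hparent (.const []))
  obtain ⟨K, hK⟩ : ∃ K : δ × Option β → Option β,
      (fun x => some (f x)) = K ∘ fun x => (digit x, ((parents x).map f).head?) := by
    refine (Function.factorsThrough_iff _).1 fun x y hxy => congrArg some ?_
    obtain ⟨hd, hp⟩ := Prod.mk.inj hxy
    by_cases hx : parent x = x <;> by_cases hy : parent y = y <;>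
      simp only [parents, hx, hy, if_true, if_false, List.map_nil, List.map_cons, List.head?_nil,
        List.head?_cons, Option.some.injEq, reduceCtorEq] at hp
    exacts [hbase x y hx hy hd, hstep x y hd hp]
  refine Primrec.nat_omega_rec' f (g := fun x l => K (digit x, l.head?)) hsize hparents ?_ ?_ ?_
  · exact (Primrec.dom_finite K).comp
      ((hdigit.comp .fst).pair (Primrec.list_head?.comp .snd))
  · intro x y hy
    by_cases hx : parent x = x
    · rw [show parents x = [] from if_pos hx] at hy
      exact absurd hy List.not_mem_nil
    · rw [show parents x = [parent x] from if_neg hx] at hy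
      exact List.mem_singleton.1 hy ▸ hlt x hx
  · exact fun x => (congrFun hK x).symm

theorem encode_int (z : ℤ) : (Encodable.encode z : ℤ) = max (2 * z) (-2 * z - 1) := by
  rcases z with n | n
  · rw [show Encodable.encode (Int.ofNat n) = 2 * n from rfl, Int.ofNat_eq_natCast]
    omega
  · rw [show Encodable.encode (Int.negSucc n) = 2 * n + 1 from rfl]
    omega

theorem encode_int_ediv_four (z : ℤ) :
    Encodable.encode (z / 4) = 2 * (Encodable.encode z / 2 / 4) + Encodable.encode z % 2 := by
  have hz := encode_int z
  have hz4 := encode_int (z / 4)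
  omega

theorem emod_four_eq_of_encode_emod_eight_eq {y z : ℤ}
    (h : Encodable.encode y % 8 = Encodable.encode z % 8) : y % 4 = z % 4 := by
  have hy := encode_int y
  have hz := encode_int z
  omega

theorem primrec_int_ediv_four : Primrec fun z : ℤ => z / 4 := by
  have two_mul_add : Primrec₂ fun m n : ℕ => 2 * m + n :=
    Primrec.nat_add.comp (Primrec.nat_mul.comp (.const 2) .fst) .snd
  refine Primrec.encode_iff.1 (.of_eq ?_ fun z => (encode_int_ediv_four z).symm)
  exact two_mul_add.comp
    (Primrec.nat_div.comp (Primrec.nat_div.comp .encode (.const 2)) (.const 4))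
    (Primrec.nat_mod.comp .encode (.const 2))

/-- The hypothesis says that `f` is computed by a finite automaton which reads the base `4` digits
of both coordinates, starting from the most significant ones. -/
theorem primrec_of_base_four {β : Type*} [Primcodable β] [Finite β] {f : Cell → β}
    (hf : ∀ r ∈ Finset.Icc (0 : Cell) 3, ∀ x y, f x = f y →
      f ((4 : ℤ) • x + r) = f ((4 : ℤ) • y + r)) : Primrec f := by
  let parent (x : Cell) : Cell := (x.1 / 4, x.2 / 4)
  let digit (x : Cell) : Fin 8 × Fin 8 :=
    (Fin.ofNat 8 (Encodable.encode x.1), Fin.ofNat 8 (Encodable.encode x.2))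
  let size (x : Cell) : ℕ := Encodable.encode x.1 + Encodable.encode x.2
  have hmod : ∀ {x y}, digit x = digit y → x.1 % 4 = y.1 % 4 ∧ x.2 % 4 = y.2 % 4 := fun h =>
    ⟨emod_four_eq_of_encode_emod_eight_eq (congrArg (Fin.val ∘ Prod.fst) h),
      emod_four_eq_of_encode_emod_eight_eq (congrArg (Fin.val ∘ Prod.snd) h)⟩
  have hdigits : ∀ x, x = (4 : ℤ) • parent x + (x.1 % 4, x.2 % 4) := fun x =>
    Prod.ext (Int.mul_ediv_add_emod x.1 4).symm (Int.mul_ediv_add_emod x.2 4).symm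
  have hofNat : Primrec (Fin.ofNat 8) := Primrec.fin_val_iff.1 (Primrec.nat_mod.comp .id (.const 8))
  refine primrec_of_finite_recursion (parent := parent) (digit := digit) (size := size)
    ?_ ?_ ?_ ?_ ?_ ?_
  · exact (primrec_int_ediv_four.comp .fst).pair (primrec_int_ediv_four.comp .snd)
  · exact (hofNat.comp (Primrec.encode.comp .fst)).pair (hofNat.comp (Primrec.encode.comp .snd))
  · exact Primrec.nat_add.comp (Primrec.encode.comp .fst) (Primrec.encode.comp .snd)
  · intro x hx
    have h1 := encode_int_ediv_four x.1
    have h2 := encode_int_ediv_four x.2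
    have e1 := encode_int x.1
    have e2 := encode_int x.2
    simp only [parent, size, ne_eq, Prod.ext_iff] at *
    omega
  · intro x y hx hy hxy
    have := hmod hxy
    simp only [parent, Prod.ext_iff] at hx hy
    exact congrArg f (Prod.ext (by omega) (by omega))
  · intro x y hxy hp
    rw [hdigits x, hdigits y, (hmod hxy).1, (hmod hxy).2]
    refine hf _ (Finset.mem_Icc.2 ?_) _ _ hp
    simp only [Prod.le_def, Prod.fst_zero, Prod.snd_zero, Prod.fst_ofNat, Prod.snd_ofNat]
    omega

theorem computablePred_of_base_four {S β : Type*} [Finite S] [Primcodable β] [Finite β]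
    {f : Cell → S} {p : Cell × β → Prop}
    (hf : ∀ r ∈ Finset.Icc (0 : Cell) 3, ∀ x y, f x = f y →
      f ((4 : ℤ) • x + r) = f ((4 : ℤ) • y + r))
    (hp : ∀ x y b, f x = f y → (p (x, b) ↔ p (y, b))) : ComputablePred p := by
  classical
  obtain ⟨N, ⟨E⟩⟩ := Finite.exists_equiv_fin S
  have hEf : Primrec (E ∘ f) := primrec_of_base_four fun r hr x y hxy =>
    congrArg E (hf r hr x y (E.injective hxy))
  obtain ⟨H, hH⟩ : ∃ H : Fin N × β → Bool,
      (fun a => decide (p a)) = H ∘ fun a : Cell × β => ((E ∘ f) a.1, a.2) := by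
    refine (Function.factorsThrough_iff _).1 ?_
    rintro ⟨x, b⟩ ⟨y, b'⟩ hxy
    obtain ⟨hE, rfl⟩ := Prod.mk.inj hxy
    exact decide_eq_decide.2 (hp x y b (E.injective hE))
  refine ⟨inferInstance, ?_⟩
  rw [hH]
  exact ((Primrec.dom_finite H).comp ((hEf.comp .fst).pair .snd)).to_comp

instance : Finite Strand := Finite.of_injective _ Strand.exit_injective

/-- The state of a finite automaton that reads the digits of `x`: for the cells near `x`, the
subtile on the cell and the central paths which its trunk joins. -/
def windowState (P : Field) (x : Cell) (t : Set.Icc (-1 : Cell) 2) : ZMod 6 × Set Strand :=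
  (P (x + t), {e | OrbitsMeet (flow P) (x + t, .trunk) (0, e)})

theorem exists_orbitsMeet_iff_of_mem (k : ZMod 6) {p : Cell × ZMod 6} (hp : p ∈ monotile) :
    ∃ o ∈ Finset.Icc (-1 : Cell) 1, ∀ {P : Field}, Rule P P → ∀ {x}, P x = k → ∀ e,
      OrbitsMeet (flow P) ((4 : ℤ) • x + rot k p.1, .trunk) (0, e) ↔
        OrbitsMeet (flow P) (x + o, .trunk) (0, e) := by
  obtain ⟨i, -, o, ho, hio⟩ := exists_iterate_eq_scale_of_mem k hp
  refine ⟨o, mem_Icc_of_hexNorm_le_one ho, fun {P} h {x} hx e => ?_⟩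
  rw [← orbitsMeet_iterate_iff i, hio h hx, h.orbitsMeet_scale_iff]

namespace Rule

variable {P : Field}

theorem exists_mem_copy_of_mem_Icc {U T : Field} (h : Rule U T) (x : Cell) {q : Cell}
    (hq : q ∈ Set.Icc (-1 : Cell) 5) :
    ∃ w ∈ Set.Icc (0 : Cell) 1, ∃ p ∈ monotile, q = (4 : ℤ) • w + rot (U (x + w)) p.1 := by
  obtain ⟨z, p, hp, -, hz⟩ := h.exists_mem_copy ((4 : ℤ) • x + q)
  obtain ⟨w, rfl⟩ : ∃ w, z = x + w := ⟨z - x, by abel⟩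
  have hqw : q = (4 : ℤ) • w + rot (U (x + w)) p.1 := by
    rw [smul_add, add_assoc] at hz
    exact add_left_cancel hz
  refine ⟨w, ?_, p, hp, hqw⟩
  have hrot := hexNorm_rot_le_two (U (x + w)) p hp
  rw [← sub_eq_iff_eq_add'.2 hqw] at hrot
  simp only [hexNorm, Set.mem_Icc, Prod.le_def, Prod.fst_sub, Prod.snd_sub, Prod.smul_fst,
    Prod.smul_snd, smul_eq_mul, Prod.fst_neg, Prod.snd_neg, Prod.fst_zero, Prod.snd_zero,
    Prod.fst_one, Prod.snd_one, Prod.fst_ofNat, Prod.snd_ofNat] at hq hrot ⊢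
  omega

theorem windowState_four_smul_add (h : Rule P P) {x y : Cell}
    (hxy : windowState P x = windowState P y) {r : Cell} (hr : r ∈ Finset.Icc (0 : Cell) 3) :
    windowState P ((4 : ℤ) • x + r) = windowState P ((4 : ℤ) • y + r) := by
  have hwindow : ∀ {q}, q ∈ Set.Icc (-1 : Cell) 2 → P (x + q) = P (y + q) ∧
      ∀ e, OrbitsMeet (flow P) (x + q, .trunk) (0, e) ↔
        OrbitsMeet (flow P) (y + q, .trunk) (0, e) := fun {q} hq =>
    ⟨congrArg Prod.fst (congrFun hxy ⟨q, hq⟩),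
      Set.ext_iff.1 (congrArg Prod.snd (congrFun hxy ⟨q, hq⟩))⟩
  funext t
  obtain ⟨hr0, hr3⟩ := Finset.mem_Icc.1 hr
  obtain ⟨w, ⟨hw0, hw1⟩, p, hp, hq⟩ :=
    h.exists_mem_copy_of_mem_Icc x (q := r + t) ⟨add_le_add hr0 t.2.1, add_le_add hr3 t.2.2⟩
  obtain ⟨o, ho, hmeet⟩ := exists_orbitsMeet_iff_of_mem (P (x + w)) hp
  obtain ⟨ho0, ho1⟩ := Finset.mem_Icc.1 ho
  have hPw : P (x + w) = P (y + w) :=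
    (hwindow ⟨le_trans (by decide) hw0, hw1.trans (by decide)⟩).1
  have hxt : (4 : ℤ) • x + r + t = (4 : ℤ) • (x + w) + rot (P (x + w)) p.1 := by
    rw [add_assoc, hq, smul_add, add_assoc]
  have hyt : (4 : ℤ) • y + r + t = (4 : ℤ) • (y + w) + rot (P (x + w)) p.1 := by
    rw [add_assoc, hq, smul_add, add_assoc]
  rw [windowState, windowState, hxt, hyt]
  refine Prod.ext ?_ (Set.ext fun e => (hmeet h rfl e).trans (.trans ?_ (hmeet h hPw.symm e).symm))
  · rw [h.apply_mem_copy _ hp, hPw, h.apply_mem_copy _ hp]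
  · rw [add_assoc, add_assoc]
    exact (hwindow ⟨add_le_add hw0 ho0, add_le_add hw1 ho1⟩).2 e

theorem computablePred_goesTo (h : Rule P P) (e : Strand) :
    ComputablePred fun s : Source => GoesTo P s e := by
  have hdir : ∀ d, dir d ∈ Set.Icc (-1 : Cell) 2 := by simp only [Set.mem_Icc]; decide
  refine computablePred_of_base_four (f := windowState P)
    (fun r hr x y hxy => h.windowState_four_smul_add hxy hr) fun x y b hxy => ?_
  have hflow : ∀ x, GoesTo P (x, b) e ↔ e ∈ (windowState P x ⟨dir (P x + Strand.exit
      (Source.node (0, b)).2), hdir _⟩).2 := fun _ => (orbitsMeet_iterate_iff 1).symm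
  have hP : P x = P y := by
    simpa [windowState] using congrArg Prod.fst (congrFun hxy ⟨0, by decide⟩)
  rw [hflow, hflow, hxy, hP]

end Rule

end HexSeed

theorem mainTheorem1_general :
    (∀ k : ZMod 6, ∃! P : HexSeed.Field, HexSeed.Rule P P ∧ P 0 = k) ∧
    (∀ P : HexSeed.Field, HexSeed.Rule P P →
      HexSeed.BuiltByRule P ∧
      (∀ (e : HexSeed.Strand) (n : ℕ),
        ((HexSeed.flow P)^[n] (0, e)).1 = n • HexSeed.dir (P 0 + e.exit)) ∧
      (∀ s : HexSeed.Source, ∃! e : HexSeed.Strand, HexSeed.GoesTo P s e) ∧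
      (∀ e : HexSeed.Strand, ComputablePred fun s : HexSeed.Source => HexSeed.GoesTo P s e) ∧
      (∀ s : HexSeed.Source, HexSeed.GoesTo P s .sourceA →
        0 < HexSeed.height (P 0) (HexSeed.flow P (HexSeed.Source.node s)).1) ∧
      (∀ s : HexSeed.Source, HexSeed.GoesTo P s .sourceB →
        HexSeed.height (P 0) (HexSeed.flow P (HexSeed.Source.node s)).1 < 0)) ∧
    (∀ T : HexSeed.Field, HexSeed.BuiltByRule T →
      HexSeed.DendritesInfinite T ∧
      (∀ s : HexSeed.Node, Function.Injective fun n : ℕ => (HexSeed.flow T)^[n] s) ∧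
      (HexSeed.dendriteGraph T).IsAcyclic ∧
      HexSeed.Nonperiodic T) :=
  ⟨HexSeed.existsUnique_rule_self,
    fun _ hP => ⟨hP.builtByRule_self, hP.flow_iterate_centre_fst,
      fun s => hP.existsUnique_orbitsMeet s.node, hP.computablePred_goesTo,
      fun _ => hP.height_flow_pos, fun _ => hP.height_flow_neg⟩,
    fun _ hT => ⟨HexSeed.functionalGraph_infinite_supp hT.periodicPts_flow,
      HexSeed.iterate_injective_of_periodicPts_eq_empty hT.periodicPts_flow,
      HexSeed.functionalGraph_isAcyclic hT.periodicPts_flow, hT.nonperiodic⟩⟩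

theorem mainTheorem1 :
    -- for each rotation of the central subtile the rule has exactly one fixed point
    (∀ k : ZMod 6, ∃! P : HexSeed.Field, HexSeed.Rule P P ∧ P 0 = k) ∧
    -- the fixed point with central subtile in standard position
    (∀ P : HexSeed.Field, HexSeed.Rule P P → P 0 = 0 →
      HexSeed.BuiltByRule P ∧
      -- the three strands of the central subtile run straight to infinity, at 180°, 60°, -120°
      (∀ (e : HexSeed.Strand) (n : ℕ),
        ((HexSeed.flow P)^[n] (0, e)).1 = n • HexSeed.dir e.exit) ∧
      -- every source goes to exactly one of these three dendrites
      (∀ s : HexSeed.Source, ∃! e : HexSeed.Strand, HexSeed.GoesTo P s e) ∧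
      -- to which one is decidable
      (∀ e : HexSeed.Strand, ComputablePred fun s : HexSeed.Source => HexSeed.GoesTo P s e) ∧
      -- only sources above (below) the horizontal dendrite go to the one at 60° (-120°)
      (∀ s : HexSeed.Source, HexSeed.GoesTo P s .sourceA →
        0 < (HexSeed.flow P (HexSeed.Source.node s)).1.2) ∧
      (∀ s : HexSeed.Source, HexSeed.GoesTo P s .sourceB →
        (HexSeed.flow P (HexSeed.Source.node s)).1.2 < 0)) ∧
    -- every tiling built by the rule has only infinite dendrites, none of them with a cycle,
    -- and is nonperiodic
    (∀ T : HexSeed.Field, HexSeed.BuiltByRule T →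
      HexSeed.DendritesInfinite T ∧
      (∀ s : HexSeed.Node, Function.Injective fun n : ℕ => (HexSeed.flow T)^[n] s) ∧
      (HexSeed.dendriteGraph T).IsAcyclic ∧
      HexSeed.Nonperiodic T) := by
  obtain ⟨hfixed, hpaths, hbuilt⟩ := mainTheorem1_general
  refine ⟨hfixed, fun P hP h0 => ?_, hbuilt⟩
  simpa only [h0, zero_add, HexSeed.height_zero] using hpaths P hP
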